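/- Let $n\ge 1$, let $p\in\mathbb{R}[x_1,\dots,x_n]$ be a non-constant polynomial and let $a\in\mathbb{R}^n$. Let $\mathbb{F}=\mathbb{R}\{\!\{\varpi\}\!\}$ be the field of Puiseux series in $\varpi$ over $\mathbb{R}$, let $\overline{\mathbb{F}}$ be its algebraic closure, and regard the field of rational functions $\mathbb{R}(\varpi)$ as a subfield of $\mathbb{F}$. Put $$\Phi_i=(x_i-a_i)\frac{\partial p}{\partial x_n}-(x_n-a_n)\frac{\partial p}{\partial x_i}\quad(1\le i\le n-1),\qquad \Phi_n=\varpi\sum_{j=1}^n (x_j-a_j)^2-1,$$ and let $$\Delta_{\overline{\mathbb{F}}}(p,a)=\Big\{x\in\overline{\mathbb{F}}^{\,n} : \Phi_1(x)=\dots=\Phi_n(x)=0,\ \frac{\partial p}{\partial x_n}(x)\neq 0\Big\}.$$ Call a polynomial $\varphi\in\mathbb{R}(\varpi)[t]$ square-free if $\gcd(\varphi,\varphi')=1$. Then there exists a square-free polynomial $\varphi_{p,a}\in\mathbb{R}(\varpi)[t]$ whose set of roots in $\overline{\mathbb{F}}$ is exactly the image $p(\Delta_{\overline{\mathbb{F}}}(p,a))$,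 and it is unique up to multiplication by a nonzero scalar in $\mathbb{R}(\varpi)$; it is called the $n$-th non-critical tangency value polynomial of $p$ at $a$. Moreover, let $I$ be the ideal of $\mathbb{R}(\varpi)[s,x_1,\dots,x_n,t]$ generated by $p(x)-t$, $\Phi_1,\dots,\Phi_n$ and $s\,\frac{\partial p}{\partial x_n}-1$. Then $I\cap\mathbb{R}(\varpi)[t]$ is generated by a nonzero polynomial, and for every generator $\bar\varphi$ of $I\cap\mathbb{R}(\varpi)[t]$ the square-free part $\bar\varphi/\gcd(\bar\varphi,\bar\varphi')$ is equal to $\varphi_{p,a}$ up to a nonzero scalar in $\mathbb{R}(\varpi)$. -/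

import Mathlib

namespace Tangency

noncomputable section

/-! ### The field of Puiseux series -/

/-- The homomorphism `ℤ → ℚ`, `m ↦ m / N`. -/
def divHom (N : ℕ+) : ℤ →+ ℚ where
  toFun m := (m : ℚ) / ((N : ℕ) : ℚ)
  map_zero' := by simp
  map_add' a b := by push_cast; ring

theorem divHom_le_iff (N : ℕ+) (a b : ℤ) : divHom N a ≤ divHom N b ↔ a ≤ b := by
  have hN : (0 : ℚ) < ((N : ℕ) : ℚ) := by exact_mod_cast N.pos
  change (a : ℚ) / ((N : ℕ) : ℚ) ≤ (b : ℚ) / ((N : ℕ) : ℚ) ↔ a ≤ b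
  rw [div_le_div_iff_of_pos_right hN]
  exact Int.cast_le

theorem divHom_injective (N : ℕ+) : Function.Injective (divHom N) := by
  intro a b h
  exact le_antisymm ((divHom_le_iff N a b).1 h.le) ((divHom_le_iff N b a).1 h.ge)

/-- The substitution `∑ₘ aₘ ϖ ^ m ↦ ∑ₘ aₘ ϖ ^ (m / N)` from Laurent series to Hahn series
with rational exponents. -/
def laurentRoot (k : Type*) [Field k] (N : ℕ+) : LaurentSeries k →+* HahnSeries ℚ k :=
  HahnSeries.embDomainRingHom (divHom N) (divHom_injective N) (divHom_le_iff N)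

theorem laurentRoot_single (k : Type*) [Field k] (N : ℕ+) (m : ℤ) (c : k) :
    laurentRoot k N (HahnSeries.single m c) =
      HahnSeries.single ((m : ℚ) / ((N : ℕ) : ℚ)) c :=
  HahnSeries.embDomain_single

theorem coeff_laurentRoot (k : Type*) [Field k] (N : ℕ+) (f : LaurentSeries k) (m : ℤ) :
    (laurentRoot k N f).coeff ((m : ℚ) / ((N : ℕ) : ℚ)) = f.coeff m :=
  HahnSeries.embDomain_mk_coeff (f := divHom N) (divHom_injective N) (divHom_le_iff N)

theorem laurentRoot_mul (k : Type*) [Field k] (N M : ℕ+) (f : LaurentSeries k) :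
    ∃ g : LaurentSeries k, laurentRoot k (N * M) g = laurentRoot k N f := by
  have hM : (0 : ℤ) < ((M : ℕ) : ℤ) := by exact_mod_cast M.pos
  have hMq : ((M : ℕ) : ℚ) ≠ 0 := by exact_mod_cast M.pos.ne'
  have hNq : ((N : ℕ) : ℚ) ≠ 0 := by exact_mod_cast N.pos.ne'
  let e : ℤ ↪o ℤ := ⟨⟨fun m => m * ((M : ℕ) : ℤ), mul_left_injective₀ hM.ne'⟩,
    by intro a b; exact mul_le_mul_iff_left₀ hM⟩
  have key : ∀ m : ℤ, (m : ℚ) / ((N : ℕ) : ℚ) =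
      ((e m : ℤ) : ℚ) / (((N * M : ℕ+) : ℕ) : ℚ) := by
    intro m
    change _ = (((m * ((M : ℕ) : ℤ) : ℤ)) : ℚ) / _
    push_cast
    field_simp
  refine ⟨HahnSeries.embDomain e f, ?_⟩
  ext q
  by_cases hq : ∃ m : ℤ, q = (m : ℚ) / ((N : ℕ) : ℚ)
  · obtain ⟨m, rfl⟩ := hq
    rw [coeff_laurentRoot, key m, coeff_laurentRoot, HahnSeries.embDomain_coeff]
  · have h1 : (laurentRoot k N f).coeff q = 0 :=
      HahnSeries.embDomain_of_notMem_range (by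
        rintro ⟨m, rfl⟩
        exact hq ⟨m, rfl⟩)
    rw [h1]
    by_cases hq' : ∃ m : ℤ, q = (m : ℚ) / (((N * M : ℕ+) : ℕ) : ℚ)
    · obtain ⟨m, rfl⟩ := hq'
      rw [coeff_laurentRoot]
      apply HahnSeries.embDomain_of_notMem_range
      rintro ⟨l, rfl⟩
      exact hq ⟨l, (key l).symm⟩
    · exact HahnSeries.embDomain_of_notMem_range (by
        rintro ⟨m, rfl⟩
        exact hq' ⟨m, rfl⟩)

theorem laurentRoot_common (k : Type*) [Field k] {x y : HahnSeries ℚ k}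
    (hx : ∃ N, x ∈ (laurentRoot k N).range) (hy : ∃ N, y ∈ (laurentRoot k N).range) :
    ∃ N, x ∈ (laurentRoot k N).range ∧ y ∈ (laurentRoot k N).range := by
  obtain ⟨N, f, rfl⟩ := hx
  obtain ⟨M, g, rfl⟩ := hy
  refine ⟨N * M, laurentRoot_mul k N M f, ?_⟩
  rw [mul_comm]
  exact laurentRoot_mul k M N g

/-- The field `k{{ϖ}}` of Puiseux series: the series `∑_{m ≥ ℓ} aₘ ϖ ^ (m / N)`, with
`ℓ : ℤ` and a positive integer `N`, inside the Hahn series with rational exponents. -/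
def puiseuxSubfield (k : Type*) [Field k] : Subfield (HahnSeries ℚ k) where
  carrier := {x | ∃ N : ℕ+, x ∈ (laurentRoot k N).range}
  zero_mem' := ⟨1, zero_mem _⟩
  one_mem' := ⟨1, one_mem _⟩
  add_mem' hx hy := by
    obtain ⟨N, h1, h2⟩ := laurentRoot_common k hx hy
    exact ⟨N, add_mem h1 h2⟩
  mul_mem' hx hy := by
    obtain ⟨N, h1, h2⟩ := laurentRoot_common k hx hy
    exact ⟨N, mul_mem h1 h2⟩
  neg_mem' := by
    rintro x ⟨N, h⟩
    exact ⟨N, neg_mem h⟩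
  inv_mem' := by
    rintro x ⟨N, f, rfl⟩
    exact ⟨N, f⁻¹, map_inv₀ _ _⟩

/-- The field `k{{ϖ}}` of Puiseux series over `k`. -/
abbrev Puiseux (k : Type*) [Field k] : Type _ := puiseuxSubfield k

/-- The embedding of `k(ϖ)` into Laurent series, expanding a rational function at `ϖ = 0`. -/
def ratFuncToLaurent (k : Type*) [Field k] : RatFunc k →+* LaurentSeries k :=
  IsFractionRing.lift (A := Polynomial k) (K := RatFunc k)
    (g := algebraMap (Polynomial k) (LaurentSeries k))
    (FaithfulSMul.algebraMap_injective (Polynomial k) (LaurentSeries k))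

/-- The embedding of `k(ϖ)` into the field of Puiseux series. -/
def ratFuncToPuiseux (k : Type*) [Field k] : RatFunc k →+* Puiseux k :=
  ((laurentRoot k 1).comp (ratFuncToLaurent k)).codRestrict
    (puiseuxSubfield k) (fun x => ⟨1, ratFuncToLaurent k x, rfl⟩)

instance ratFuncPuiseuxAlgebra (k : Type*) [Field k] : Algebra (RatFunc k) (Puiseux k) :=
  (ratFuncToPuiseux k).toAlgebra

/-- The variable of `k(ϖ)` is sent to the Puiseux series `ϖ`. -/
theorem algebraMap_X_puiseux (k : Type*) [Field k] :
    ((algebraMap (RatFunc k) (Puiseux k) RatFunc.X : Puiseux k) : HahnSeries ℚ k) =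
      HahnSeries.single 1 1 := by
  change laurentRoot k 1 (ratFuncToLaurent k RatFunc.X) = _
  have h : ratFuncToLaurent k RatFunc.X = HahnSeries.single 1 1 := by
    rw [ratFuncToLaurent, ← RatFunc.algebraMap_X, IsFractionRing.lift_algebraMap]
    simp
  rw [h, laurentRoot_single]
  simp

/-- A constant is sent to the constant Puiseux series. -/
theorem algebraMap_C_puiseux (k : Type*) [Field k] (c : k) :
    ((algebraMap (RatFunc k) (Puiseux k) (RatFunc.C c) : Puiseux k) : HahnSeries ℚ k) =
      HahnSeries.single 0 c := by
  change laurentRoot k 1 (ratFuncToLaurent k (RatFunc.C c)) = _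
  have h : ratFuncToLaurent k (RatFunc.C c) = HahnSeries.single 0 c := by
    rw [ratFuncToLaurent, ← RatFunc.algebraMap_C, IsFractionRing.lift_algebraMap]
    simp
  rw [h, laurentRoot_single]
  simp

/-- The field `ℝ(ϖ)`; its variable `RatFunc.X` is `ϖ`. -/
abbrev K : Type := RatFunc ℝ

/-- The algebraic closure `𝔽̄` of the field `𝔽 = ℝ{{ϖ}}`. -/
abbrev Fbar : Type := AlgebraicClosure (Puiseux ℝ)

/-! ### Tangency points

The number of variables is `n = m + 1`; the `n`-th variable has index `Fin.last m`. -/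

/-- The polynomial `p`, viewed with coefficients in `ℝ(ϖ)`. -/
def coeffK {σ : Type*} (p : MvPolynomial σ ℝ) : MvPolynomial σ K :=
  MvPolynomial.map (RatFunc.C : ℝ →+* K) p

/-- The coordinate difference `xⱼ - aⱼ`. -/
def shift {m : ℕ} (a : Fin (m + 1) → ℝ) (j : Fin (m + 1)) : MvPolynomial (Fin (m + 1)) K :=
  MvPolynomial.X j - MvPolynomial.C (RatFunc.C (a j))

/-- The partial derivative of `p` in the variable `xⱼ`, over `ℝ(ϖ)`. -/
def partialK {m : ℕ} (p : MvPolynomial (Fin (m + 1)) ℝ) (j : Fin (m + 1)) :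
    MvPolynomial (Fin (m + 1)) K :=
  coeffK (MvPolynomial.pderiv j p)

/-- `Φᵢ = (xᵢ - aᵢ) ∂p/∂xₙ - (xₙ - aₙ) ∂p/∂xᵢ` for `i = 1, …, n - 1`. -/
def Phi {m : ℕ} (p : MvPolynomial (Fin (m + 1)) ℝ) (a : Fin (m + 1) → ℝ) (i : Fin m) :
    MvPolynomial (Fin (m + 1)) K :=
  shift a i.castSucc * partialK p (Fin.last m) - shift a (Fin.last m) * partialK p i.castSucc

/-- `Φₙ = ϖ ((x₁ - a₁)² + ⋯ + (xₙ - aₙ)²) - 1`. -/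
def PhiLast {m : ℕ} (a : Fin (m + 1) → ℝ) : MvPolynomial (Fin (m + 1)) K :=
  MvPolynomial.C RatFunc.X * (∑ j, shift a j ^ 2) - 1

/-- The set `Γ(p, a)` of tangency points of `p` at `a` over `𝔽̄`. -/
def Gamma {m : ℕ} (p : MvPolynomial (Fin (m + 1)) ℝ) (a : Fin (m + 1) → ℝ) :
    Set (Fin (m + 1) → Fbar) :=
  {x | (∀ i : Fin m, MvPolynomial.aeval x (Phi p a i) = 0) ∧
    MvPolynomial.aeval x (PhiLast a) = 0}

/-- The zero set of `∂p/∂xₙ` over `𝔽̄`. -/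
def lastPartialZeros {m : ℕ} (p : MvPolynomial (Fin (m + 1)) ℝ) : Set (Fin (m + 1) → Fbar) :=
  {x | MvPolynomial.aeval x (partialK p (Fin.last m)) = 0}

/-- The `n`-th set `Δ(p, a)` of non-critical tangency points of `p` at `a` over `𝔽̄`. -/
def Delta {m : ℕ} (p : MvPolynomial (Fin (m + 1)) ℝ) (a : Fin (m + 1) → ℝ) :
    Set (Fin (m + 1) → Fbar) :=
  Gamma p a \ lastPartialZeros p

/-- The set `p(Δ(p, a))` of values of `p` at the non-critical tangency points. -/
def tangencyValues {m : ℕ} (p : MvPolynomial (Fin (m + 1)) ℝ) (a : Fin (m + 1) → ℝ) :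
    Set Fbar :=
  (fun x => MvPolynomial.aeval x (coeffK p)) '' Delta p a

/-- `φ ∈ ℝ(ϖ)[t]` is an `n`-th non-critical tangency value polynomial of `p` at `a`: it is
square-free, in the sense that `φ` and `φ'` are coprime (`Polynomial.Separable`), and its
roots in `𝔽̄` are exactly the elements of `p(Δ(p, a))`. -/
def IsTangencyValuePolynomial {m : ℕ} (p : MvPolynomial (Fin (m + 1)) ℝ)
    (a : Fin (m + 1) → ℝ) (φ : Polynomial K) : Prop :=
  φ.Separable ∧ {t : Fbar | Polynomial.aeval t φ = 0} = tangencyValues p a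

/-! ### The elimination ideal -/

/-- The variables of `ℝ(ϖ)[s, x, t]`. -/
inductive ElimVar (m : ℕ) : Type
  | s : ElimVar m
  | x (j : Fin (m + 1)) : ElimVar m
  | t : ElimVar m

/-- The inclusion `ℝ(ϖ)[x] → ℝ(ϖ)[s, x, t]`. -/
def inclX (m : ℕ) : MvPolynomial (Fin (m + 1)) K →ₐ[K] MvPolynomial (ElimVar m) K :=
  MvPolynomial.rename ElimVar.x

/-- The inclusion `ℝ(ϖ)[t] → ℝ(ϖ)[s, x, t]`. -/
def inclT (m : ℕ) : Polynomial K →ₐ[K] MvPolynomial (ElimVar m) K :=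
  Polynomial.aeval (MvPolynomial.X ElimVar.t)

/-- The ideal `I = ⟨p - t, Φ₁, …, Φₙ, s ∂p/∂xₙ - 1⟩` of `ℝ(ϖ)[s, x, t]`. -/
def tangencyIdeal {m : ℕ} (p : MvPolynomial (Fin (m + 1)) ℝ) (a : Fin (m + 1) → ℝ) :
    Ideal (MvPolynomial (ElimVar m) K) :=
  Ideal.span
    ({inclX m (coeffK p) - MvPolynomial.X ElimVar.t} ∪
      Set.range (fun i : Fin m => inclX m (Phi p a i)) ∪
      {inclX m (PhiLast a)} ∪
      {MvPolynomial.X ElimVar.s * inclX m (partialK p (Fin.last m)) - 1})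

/-- The elimination ideal `I ∩ ℝ(ϖ)[t]`. -/
def elimIdeal {m : ℕ} (p : MvPolynomial (Fin (m + 1)) ℝ) (a : Fin (m + 1) → ℝ) :
    Ideal (Polynomial K) :=
  (tangencyIdeal p a).comap (inclT m)

/-- `θ` is a square-free part of `f`: `f = θ * g` for a greatest common divisor `g` of
`f` and its derivative. -/
def IsSquarefreePart (f θ : Polynomial K) : Prop :=
  ∃ g : Polynomial K, g ∣ f ∧ g ∣ Polynomial.derivative f ∧
    (∀ d : Polynomial K, d ∣ f → d ∣ Polynomial.derivative f → d ∣ g) ∧ f = θ * g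

end

end Tangency

/-! At a non-critical tangency point the gradient of `p` is proportional to `x - a`, while `ϖ |x -
a|² = 1` makes `x - a` orthogonal to `D x` for every derivation `D` over `ℝ(ϖ)`. Hence `D (p x) =
0`. In characteristic zero a transcendental element of an essentially finitely generated extension
has nonzero image under some derivation, so `p x` is algebraic over `ℝ(ϖ)` (`isAlgebraic_value`).

Applied to the generic point of a prime containing `I`, this rules out `I ∩ ℝ(ϖ)[t] = 0`
(`exists_ne_zero_mem_elimIdeal`). The roots of a generator are then finitely many, and the
Nullstellensatz lifts each one to an actual point, so no closure of the image is needed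
(`root_iff_mem_tangencyValues`). Dividing by the gcd with the derivative keeps the roots and makes
them simple; a separable polynomial is determined by its roots up to a scalar. -/

namespace Tangency

/-! ### Derivations and separable polynomials -/

section FieldTheory

open Polynomial

/-- Taking `φ` as a bare homomorphism leaves the `R`-algebra structure on `B` free; below, `B` is
the dual numbers with a twisted `k[X]`-structure. -/
theorem exists_ringHom_lift {R A B : Type*} [CommRing R] [CommRing A] [CommRing B] [Algebra R A]
    [Algebra.FormallySmooth R A] (φ : R →+* B) (π : B →+* A) (hπ : Function.Surjective π)
    (hker : IsNilpotent (RingHom.ker π)) (h : π.comp φ = algebraMap R A) :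
    ∃ g : A →+* B, (∀ x, π (g x) = x) ∧ ∀ r, g (algebraMap R A r) = φ r := by
  let := φ.toAlgebra
  let π' : B →ₐ[R] A := ⟨π, fun r => congr($h r)⟩
  refine ⟨(Algebra.FormallySmooth.liftOfSurjective (AlgHom.id R A) π' hπ hker).toRingHom, ?_, ?_⟩
  · intro x
    exact Algebra.FormallySmooth.liftOfSurjective_apply (AlgHom.id R A) π' hπ hker x
  · intro r
    exact AlgHom.commutes _ r

/-- A transcendental element of an extension of fields of characteristic zero that is essentially
of finite type is not killed by all derivations. -/
theorem exists_derivation_eq_one {k L : Type*} [Field k] [CharZero k] [Field L] [Algebra k L]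
    [Algebra.EssFiniteType k L] {y : L} (hy : Transcendental k y) :
    ∃ D : Derivation k L L, D y = 1 := by
  let : Algebra k[X] L := (aeval y).toAlgebra
  have hmap : ∀ f : k[X], algebraMap k[X] L f = aeval y f := fun _ => rfl
  have : IsScalarTower k k[X] L := .of_algebraMap_eq fun r => by simp [hmap]
  have : FaithfulSMul k[X] L := (faithfulSMul_iff_algebraMap_injective _ _).2
    (transcendental_iff_injective.1 hy)
  let : Algebra (FractionRing k[X]) L := FractionRing.liftAlgebra k[X] L
  have : IsScalarTower k[X] (FractionRing k[X]) L := inferInstance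
  have : IsScalarTower k (FractionRing k[X]) L := .of_algebraMap_eq fun r => by
    rw [IsScalarTower.algebraMap_apply k k[X] L, IsScalarTower.algebraMap_apply k k[X]
      (FractionRing k[X]), ← IsScalarTower.algebraMap_apply k[X] (FractionRing k[X]) L]
  have : CharZero (FractionRing k[X]) := charZero_of_injective_algebraMap
    (IsFractionRing.injective k[X] (FractionRing k[X]))
  -- In characteristic zero, `L` is formally smooth over `k(X)`, hence over `k[X]` with `X ↦ y`.
  have : Algebra.EssFiniteType (FractionRing k[X]) L := .of_comp k _ _
  have : Algebra.FormallySmooth k[X] (FractionRing k[X]) :=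
    .of_isLocalization (nonZeroDivisors k[X])
  have : Algebra.FormallySmooth k[X] L := .comp k[X] (FractionRing k[X]) L
  let π : TrivSqZeroExt L L →ₐ[k] L := TrivSqZeroExt.fstHom k L L
  -- Lifting the identity of `L` along `L[ε] → L` with `X ↦ y + ε` gives `x ↦ x + ε D x` with `D y =
  -- 1`.
  let e : TrivSqZeroExt L L := TrivSqZeroExt.inl y + TrivSqZeroExt.inr 1
  let φ : k[X] →ₐ[k] TrivSqZeroExt L L := aeval e
  have he : π e = y := by simp [π, e]
  obtain ⟨g, hg1, hg2⟩ := exists_ringHom_lift (A := L) φ.toRingHom π.toRingHom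
    (fun x => ⟨TrivSqZeroExt.inl x, by simp [π]⟩)
    ⟨2, by
      rw [pow_two, Ideal.zero_eq_bot, eq_bot_iff, Ideal.mul_le]
      intro a ha b hb
      have ha' : a.fst = 0 := ha
      have hb' : b.fst = 0 := hb
      rw [Ideal.mem_bot]
      ext <;> simp [ha', hb']⟩
    (RingHom.ext fun f => by
      change π (aeval e f) = aeval y f
      rw [← Polynomial.aeval_algHom_apply, he])
  have hfst : ∀ x, (g x).fst = x := hg1
  have hk : ∀ c : k, g (algebraMap k L c) = algebraMap k _ c := fun c => by
    have := hg2 (C c)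
    rwa [hmap, aeval_C, show φ.toRingHom (C c) = algebraMap k _ c from aeval_C e c] at this
  have hy' : g y = e := by
    have := hg2 X
    rwa [hmap, aeval_X, show φ.toRingHom X = e from aeval_X e] at this
  refine ⟨⟨⟨⟨fun x => (g x).snd, fun a b => by simp⟩, fun c x => ?_⟩, ?_, fun a b => ?_⟩, ?_⟩
  · simp [Algebra.smul_def, hk, hfst, TrivSqZeroExt.algebraMap_eq_inl']
  · simp
  · simp [hfst, mul_comm]
  · simp [hy', e]

theorem derivation_mvPolynomial_aeval {k L σ : Type*} [CommRing k] [CommRing L] [Algebra k L]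
    [Fintype σ] (D : Derivation k L L) (x : σ → L) (f : MvPolynomial σ k) :
    D (MvPolynomial.aeval x f) =
      ∑ j, MvPolynomial.aeval x (MvPolynomial.pderiv j f) * D (x j) := by
  classical
  induction f using MvPolynomial.induction_on with
  | C a => simp
  | add f g hf hg => simp [hf, hg, add_mul, Finset.sum_add_distrib]
  | mul_X f i hf =>
    simp only [map_mul, MvPolynomial.aeval_X, Derivation.leibniz, hf, smul_eq_mul, map_add,
      MvPolynomial.pderiv_X, add_mul, Finset.sum_add_distrib, Finset.mul_sum]
    congr 1
    · rw [Finset.sum_eq_single i] <;> simp +contextual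
    · exact Finset.sum_congr rfl fun j _ => by ring

variable {k F : Type*} [Field k] [Field F] [IsAlgClosed F] [Algebra k F]

/-- Over `F` divisibility is inclusion of root multisets, which for simple roots is inclusion of
sets; divisibility descends from `F` to `k`. -/
theorem Separable.dvd_of_forall_root {f g : k[X]} (hf : f.Separable) (hg : g ≠ 0)
    (h : ∀ t : F, aeval t f = 0 → aeval t g = 0) : f ∣ g := by
  classical
  have hg' : g.map (algebraMap k F) ≠ 0 := (Polynomial.map_ne_zero_iff
    (algebraMap k F).injective).2 hg
  rw [← Polynomial.map_dvd_map' (algebraMap k F),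
    IsAlgClosed.dvd_iff_roots_le_roots (hf.map).ne_zero hg',
    Multiset.le_iff_subset (nodup_roots hf.map)]
  intro t ht
  have h1 := (mem_roots'.1 ht).2
  rw [mem_roots hg']
  rw [IsRoot, eval_map_algebraMap] at h1 ⊢
  exact h t h1

theorem associated_of_separable_of_root_iff {f g : k[X]} (hf : f.Separable) (hg : g.Separable)
    (h : ∀ t : F, aeval t f = 0 ↔ aeval t g = 0) : Associated f g :=
  associated_of_dvd_dvd (Separable.dvd_of_forall_root (F := F) hf hg.ne_zero fun t => (h t).1)
    (Separable.dvd_of_forall_root (F := F) hg hf.ne_zero fun t => (h t).2)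

/-- Division by the greatest common divisor with the derivative makes all roots simple and keeps
the set of roots. -/
theorem separable_and_root_iff_of_eq_mul_gcd [CharZero k] {f g θ : k[X]} (hf : f ≠ 0)
    (hgf' : g ∣ derivative f)
    (hgcd : ∀ d, d ∣ f → d ∣ derivative f → d ∣ g) (hfθ : f = θ * g) :
    θ.Separable ∧ ∀ t : F, aeval t θ = 0 ↔ aeval t f = 0 := by
  classical
  have : CharZero F := charZero_of_injective_algebraMap (algebraMap k F).injective
  set i := algebraMap k F
  have hmap : ∀ {q : k[X]}, q ≠ 0 → q.map i ≠ 0 := fun h =>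
    (Polynomial.map_ne_zero_iff i.injective).2 h
  have hθ : θ ≠ 0 := by rintro rfl; simp at hfθ; exact hf hfθ
  have hg : g ≠ 0 := by rintro rfl; simp at hfθ; exact hf hfθ
  have hmul : ∀ t : F, (f.map i).rootMultiplicity t =
      (θ.map i).rootMultiplicity t + (g.map i).rootMultiplicity t := fun t => by
    rw [hfθ, Polynomial.map_mul, rootMultiplicity_mul (mul_ne_zero (hmap hθ) (hmap hg))]
  -- A root of multiplicity `n` in `f` has multiplicity `n - 1` in `f'`, hence in `g`, because the
  -- gcd is preserved by extending scalars. So `θ` retains exactly one factor.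
  have hone : ∀ t : F, (f.map i).IsRoot t → (θ.map i).rootMultiplicity t = 1 := by
    intro t ht
    have hpos : 0 < (f.map i).rootMultiplicity t := (rootMultiplicity_pos (hmap hf)).2 ht
    have hder := derivative_rootMultiplicity_of_root ht
    rw [derivative_map] at hder
    have hf' : derivative f ≠ 0 := by
      intro h0
      obtain ⟨c, rfl⟩ := natDegree_eq_zero.1 (derivative_eq_zero.1 h0)
      exact hf (by simpa using ht)
    have hle : (g.map i).rootMultiplicity t ≤ (f.map i).rootMultiplicity t - 1 := by
      rw [← hder]
      exact rootMultiplicity_le_rootMultiplicity_of_dvd (hmap hf') ((map_dvd_map' i).2 hgf') t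
    have hge : (f.map i).rootMultiplicity t - 1 ≤ (g.map i).rootMultiplicity t := by
      rw [le_rootMultiplicity_iff (hmap hg)]
      have hd : EuclideanDomain.gcd f (derivative f) ∣ g :=
        hgcd _ (EuclideanDomain.gcd_dvd_left _ _) (EuclideanDomain.gcd_dvd_right _ _)
      refine dvd_trans ?_ ((map_dvd_map' i).2 hd)
      rw [← gcd_map]
      refine EuclideanDomain.dvd_gcd ?_ ?_
      · exact (pow_dvd_pow _ (Nat.sub_le _ _)).trans (pow_rootMultiplicity_dvd _ _)
      · rw [← hder]
        exact pow_rootMultiplicity_dvd _ _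
    have := hmul t
    omega
  have hroot : ∀ t : F, (θ.map i).IsRoot t ↔ (f.map i).IsRoot t := by
    intro t
    refine ⟨fun h => ?_, fun h => ?_⟩
    · rw [← rootMultiplicity_pos (hmap hf), hmul]
      exact Nat.add_pos_left ((rootMultiplicity_pos (hmap hθ)).2 h) _
    · rw [← rootMultiplicity_pos (hmap hθ), hone t h]
      exact one_pos
  refine ⟨?_, fun t => ?_⟩
  · rw [← separable_map i, ← nodup_roots_iff_of_splits (hmap hθ) (IsAlgClosed.splits _),
      Multiset.nodup_iff_count_le_one]
    intro t
    rw [count_roots]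
    by_cases ht : (θ.map i).IsRoot t
    · exact (hone t ((hroot t).1 ht)).le
    · rw [rootMultiplicity_eq_zero ht]; exact zero_le_one
  · have := hroot t
    rwa [IsRoot, IsRoot, eval_map_algebraMap, eval_map_algebraMap] at this

end FieldTheory

instance ElimVar.finite (m : ℕ) : Finite (ElimVar m) := by
  refine Finite.of_injective
    (fun v : ElimVar m => (ElimVar.rec (some none) (fun j => some (some j)) none v :
      Option (Option (Fin (m + 1))))) ?_
  rintro (_ | _ | _) (_ | _ | _) h <;> simp_all

/-! ### Tangency points and the elimination ideal -/

section Points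

variable {m : ℕ} {p : MvPolynomial (Fin (m + 1)) ℝ} {a : Fin (m + 1) → ℝ}

/-- Non-critical tangency points with coordinates in an extension field of `ℝ(ϖ)`. -/
structure IsNoncriticalTangencyPoint (p : MvPolynomial (Fin (m + 1)) ℝ) (a : Fin (m + 1) → ℝ)
    {L : Type*} [Field L] [Algebra K L] (x : Fin (m + 1) → L) : Prop where
  phi : ∀ i : Fin m, MvPolynomial.aeval x (Phi p a i) = 0
  phiLast : MvPolynomial.aeval x (PhiLast a) = 0
  partial_ne : MvPolynomial.aeval x (partialK p (Fin.last m)) ≠ 0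

theorem mem_Delta_iff {x : Fin (m + 1) → Fbar} :
    x ∈ Delta p a ↔ IsNoncriticalTangencyPoint p a x :=
  ⟨fun h => ⟨h.1.1, h.1.2, h.2⟩, fun h => ⟨⟨h.phi, h.phiLast⟩, h.partial_ne⟩⟩

variable {L : Type*} [Field L] [Algebra K L]

/-- The value of `p` at a non-critical tangency point is algebraic over `ℝ(ϖ)`: every derivation
over `ℝ(ϖ)` kills it, since the gradient of `p` is proportional to `x - a` there. -/
theorem IsNoncriticalTangencyPoint.isAlgebraic_value [Algebra.EssFiniteType K L]
    {x : Fin (m + 1) → L} (h : IsNoncriticalTangencyPoint p a x) :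
    IsAlgebraic K (MvPolynomial.aeval x (coeffK p)) := by
  by_contra htr
  have : CharZero K := charZero_of_injective_algebraMap (algebraMap ℝ K).injective
  obtain ⟨D, hD⟩ := exists_derivation_eq_one htr
  set y : Fin (m + 1) → L := fun j => MvPolynomial.aeval x (shift a j) with hy
  set d : Fin (m + 1) → L := fun j => MvPolynomial.aeval x (partialK p j) with hd
  have hd0 : d (Fin.last m) ≠ 0 := h.partial_ne
  have hyd : ∀ j, y j * d (Fin.last m) = y (Fin.last m) * d j := by
    intro j
    induction j using Fin.lastCases with
    | last => rfl
    | cast i =>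
      have := h.phi i
      rw [Phi, map_sub, map_mul, map_mul] at this
      exact sub_eq_zero.1 this
  have hlast : algebraMap K L RatFunc.X * ∑ j, y j ^ 2 = 1 := by
    have := h.phiLast
    rw [PhiLast, map_sub, map_mul, map_sum, map_one, MvPolynomial.aeval_C, sub_eq_zero] at this
    simpa only [map_pow] using this
  have hX : algebraMap K L RatFunc.X ≠ 0 := left_ne_zero_of_mul (hlast ▸ one_ne_zero)
  have hDy : ∀ j, D (y j) = D (x j) := fun j => by
    simp [hy, shift, map_sub]
  -- Differentiate the sphere equation; `ϖ` is a constant for `D`.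
  have hsum : ∑ j, y j * D (x j) = 0 := by
    have := congrArg D hlast
    rw [Derivation.leibniz, Derivation.map_algebraMap, Derivation.map_one_eq_zero, smul_zero, add_zero,
      smul_eq_mul, map_sum] at this
    have h2 := (mul_eq_zero.1 this).resolve_left hX
    simp only [Derivation.leibniz_pow, hDy, smul_eq_mul, nsmul_eq_mul, Nat.add_one_sub_one,
      pow_one, ← Finset.mul_sum] at h2
    have : CharZero L := charZero_of_injective_algebraMap (algebraMap K L).injective
    exact (mul_eq_zero.1 h2).resolve_left (by simp)
  have hDp : ∑ j, d j * D (x j) = 1 := by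
    rw [← hD, derivation_mvPolynomial_aeval]
    refine Finset.sum_congr rfl fun j _ => ?_
    rw [coeffK, MvPolynomial.pderiv_map]
    rfl
  -- Multiply `∑ d j * D (x j) = 1` by the last `y` and exchange `y` and `d` by proportionality. All
  -- of `x - a` then vanishes, contradicting the sphere equation.
  have hyl : y (Fin.last m) = 0 := by
    calc y (Fin.last m) = ∑ j, (y (Fin.last m) * d j) * D (x j) := by
          simp only [mul_assoc, ← Finset.mul_sum, hDp, mul_one]
      _ = d (Fin.last m) * ∑ j, y j * D (x j) := by
          rw [Finset.mul_sum]
          exact Finset.sum_congr rfl fun j _ => by rw [← hyd]; ring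
      _ = 0 := by rw [hsum, mul_zero]
  have hy0 : ∀ j, y j = 0 := fun j => by
    have := hyd j
    rw [hyl, zero_mul] at this
    exact (mul_eq_zero.1 this).resolve_right hd0
  simp [hy0] at hlast

theorem isNoncriticalTangencyPoint_of_tangencyIdeal_le_ker
    {ev : MvPolynomial (ElimVar m) K →ₐ[K] L} (h : ∀ f ∈ tangencyIdeal p a, ev f = 0) :
    IsNoncriticalTangencyPoint p a (fun j => ev (MvPolynomial.X (ElimVar.x j))) ∧
    MvPolynomial.aeval (fun j => ev (MvPolynomial.X (ElimVar.x j))) (coeffK p) =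
      ev (MvPolynomial.X ElimVar.t) := by
  have hev : ∀ f, ev (inclX m f) =
      MvPolynomial.aeval (fun j => ev (MvPolynomial.X (ElimVar.x j))) f := by
    intro f
    rw [← AlgHom.comp_apply]
    congr 1
    ext j
    simp [inclX]
  have hgen : ∀ f ∈ _, ev f = 0 := fun f hf => h f (Ideal.subset_span hf)
  have h1 := hgen (inclX m (coeffK p) - MvPolynomial.X ElimVar.t) (by simp)
  have h2 := fun i : Fin m => hgen (inclX m (Phi p a i)) (by simp)
  have h3 := hgen (inclX m (PhiLast a)) (by simp)
  have h4 := hgen (MvPolynomial.X ElimVar.s * inclX m (partialK p (Fin.last m)) - 1) (by simp)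
  rw [map_sub, hev, sub_eq_zero] at h1
  simp only [hev] at h2 h3
  rw [map_sub, map_mul, map_one, hev, sub_eq_zero] at h4
  exact ⟨⟨h2, h3, right_ne_zero_of_mul (h4 ▸ one_ne_zero)⟩, h1⟩

/-- Converse of the previous lemma: `s` must go to the inverse of the last partial derivative and
`t` to the value of `p`. -/
theorem IsNoncriticalTangencyPoint.exists_algHom {x : Fin (m + 1) → L}
    (h : IsNoncriticalTangencyPoint p a x) :
    ∃ ev : MvPolynomial (ElimVar m) K →ₐ[K] L, (∀ f ∈ tangencyIdeal p a, ev f = 0) ∧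
      ev (MvPolynomial.X ElimVar.t) = MvPolynomial.aeval x (coeffK p) := by
  let ev : MvPolynomial (ElimVar m) K →ₐ[K] L := MvPolynomial.aeval fun v =>
    ElimVar.rec (MvPolynomial.aeval x (partialK p (Fin.last m)))⁻¹ x
      (MvPolynomial.aeval x (coeffK p)) v
  have hev : ∀ f, ev (inclX m f) = MvPolynomial.aeval x f := fun f =>
    MvPolynomial.aeval_rename _ _ _
  have ht : ev (MvPolynomial.X ElimVar.t) = MvPolynomial.aeval x (coeffK p) :=
    MvPolynomial.aeval_X _ _
  have hs : ev (MvPolynomial.X ElimVar.s) =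
      (MvPolynomial.aeval x (partialK p (Fin.last m)))⁻¹ := MvPolynomial.aeval_X _ _
  refine ⟨ev, fun f hf => ?_, ht⟩
  have hle : tangencyIdeal p a ≤ RingHom.ker ev := by
    rw [tangencyIdeal, Ideal.span_le]
    rintro f (((rfl | ⟨i, rfl⟩) | rfl) | rfl) <;>
      simp only [SetLike.mem_coe, RingHom.mem_ker, map_sub, map_mul, map_one, hev, ht, hs]
    · exact sub_self _
    · exact h.phi i
    · exact h.phiLast
    · rw [inv_mul_cancel₀ h.partial_ne, sub_self]
  exact hle hf

theorem map_inclT {L : Type*} [CommRing L] [Algebra K L]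
    (ev : MvPolynomial (ElimVar m) K →ₐ[K] L) (f : Polynomial K) :
    ev (inclT m f) = Polynomial.aeval (ev (MvPolynomial.X ElimVar.t)) f :=
  (Polynomial.aeval_algHom_apply ev _ f).symm

/-- The images of the variables form a tangency point over the fraction field of `A`, which is
essentially of finite type over `K`. -/
theorem isAlgebraic_of_tangencyIdeal_le_ker {A : Type*} [CommRing A] [IsDomain A] [Algebra K A]
    [Algebra.FiniteType K A] (q : MvPolynomial (ElimVar m) K →ₐ[K] A)
    (h : ∀ f ∈ tangencyIdeal p a, q f = 0) :
    IsAlgebraic K (q (MvPolynomial.X ElimVar.t)) := by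
  have : Algebra.EssFiniteType A (FractionRing A) := .of_isLocalization _ (nonZeroDivisors A)
  have : Algebra.EssFiniteType K (FractionRing A) := .comp K A _
  obtain ⟨hpt, hval⟩ := isNoncriticalTangencyPoint_of_tangencyIdeal_le_ker (p := p) (a := a)
    (ev := (IsScalarTower.toAlgHom K A (FractionRing A)).comp q) fun f hf => by
      rw [AlgHom.comp_apply, h f hf, map_zero]
  have halg := hpt.isAlgebraic_value
  rw [hval] at halg
  exact (isAlgebraic_algHom_iff (IsScalarTower.toAlgHom K A (FractionRing A))
    (IsFractionRing.injective A (FractionRing A))).1 halg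

variable (p a) in
theorem exists_ne_zero_mem_elimIdeal : ∃ f ∈ elimIdeal p a, f ≠ 0 := by
  by_contra! hbot
  have hdisj : Disjoint (tangencyIdeal p a : Set (MvPolynomial (ElimVar m) K))
      ((nonZeroDivisors (Polynomial K)).map (inclT m)) := by
    rw [Set.disjoint_left]
    rintro _ hf ⟨g, hg, rfl⟩
    exact nonZeroDivisors.ne_zero hg (hbot g hf)
  -- Modulo `P` no nonzero polynomial in `t` vanishes, although `t` must be algebraic there.
  obtain ⟨P, hP, hle, hPd⟩ := Ideal.exists_le_prime_disjoint _ _ hdisj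
  obtain ⟨f, hf0, hf⟩ := isAlgebraic_of_tangencyIdeal_le_ker (Ideal.Quotient.mkₐ K P)
    fun f hf => Ideal.Quotient.eq_zero_iff_mem.2 (hle hf)
  rw [← map_inclT] at hf
  exact Set.disjoint_left.1 hPd (Ideal.Quotient.eq_zero_iff_mem.1 hf)
    ⟨f, mem_nonZeroDivisors_of_ne_zero hf0, rfl⟩

theorem ne_zero_of_span_eq_elimIdeal {φ : Polynomial K}
    (hφ : Ideal.span {φ} = elimIdeal p a) : φ ≠ 0 := by
  rintro rfl
  obtain ⟨f, hf, hf0⟩ := exists_ne_zero_mem_elimIdeal p a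
  rw [← hφ, Ideal.mem_span_singleton, zero_dvd_iff] at hf
  exact hf0 hf

/-- A generator of the elimination ideal vanishes exactly at the values of `p`. -/
theorem root_iff_mem_tangencyValues {φ : Polynomial K}
    (hφ : Ideal.span {φ} = elimIdeal p a) (t : Fbar) :
    Polynomial.aeval t φ = 0 ↔ t ∈ tangencyValues p a := by
  have hφI : inclT m φ ∈ tangencyIdeal p a := by
    have : φ ∈ elimIdeal p a := hφ ▸ Ideal.mem_span_singleton_self φ
    exact this
  constructor
  · intro ht
    have hφ0 : φ ≠ 0 := ne_zero_of_span_eq_elimIdeal hφ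
    have hint : IsIntegral K t := IsAlgebraic.isIntegral ⟨φ, hφ0, ht⟩
    set g := minpoly K t
    obtain ⟨h, hgh⟩ := minpoly.dvd K t ht
    -- Write `φ = g * h`. If `1` were in the sum, multiplying by `h` would put `h` in the
    -- elimination ideal, so `φ ∣ h` and `g` would be a unit.
    have hne : tangencyIdeal p a ⊔ Ideal.span {inclT m g} ≠ ⊤ := by
      intro htop
      obtain ⟨u, hu, v, hv, huv⟩ := Submodule.mem_sup.1 ((Ideal.eq_top_iff_one _).1 htop)
      obtain ⟨w, rfl⟩ := Ideal.mem_span_singleton'.1 hv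
      have hmem : h ∈ elimIdeal p a := by
        have : inclT m h = inclT m h * u + w * inclT m φ := by
          rw [hgh, map_mul]
          linear_combination (-inclT m h) * huv
        change inclT m h ∈ tangencyIdeal p a
        rw [this]
        exact add_mem (Ideal.mul_mem_left _ _ hu) (Ideal.mul_mem_left _ _ hφI)
      rw [← hφ, Ideal.mem_span_singleton] at hmem
      obtain ⟨c, hc⟩ := hmem
      have hh : h ≠ 0 := by rintro rfl; exact hφ0 (by simpa using hgh)
      refine minpoly.not_isUnit K t (IsUnit.of_mul_eq_one c ?_)
      refine mul_left_cancel₀ hh ?_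
      rw [mul_one]
      conv_rhs => rw [hc, hgh]
      ring
    obtain ⟨M, hM, hle⟩ := Ideal.exists_le_maximal _ hne
    let := Ideal.Quotient.field M
    -- By Zariski's lemma the residue field is finite over `K`. The class of `t` there has minimal
    -- polynomial `g`, so the field embeds in `Fbar` with that class sent to the given root.
    have : Module.Finite K (MvPolynomial (ElimVar m) K ⧸ M) :=
      finite_of_finite_type_of_isJacobsonRing K _
    let q := Ideal.Quotient.mkₐ K M
    have hgq : Polynomial.aeval (q (MvPolynomial.X ElimVar.t)) g = 0 := by
      rw [← map_inclT]
      exact Ideal.Quotient.eq_zero_iff_mem.2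
        (hle (Ideal.mem_sup_right (Ideal.mem_span_singleton_self _)))
    have hmin : g = minpoly K (q (MvPolynomial.X ElimVar.t)) :=
      minpoly.eq_of_irreducible_of_monic (minpoly.irreducible hint) hgq (minpoly.monic hint)
    obtain ⟨ι, hι⟩ := IntermediateField.exists_algHom_of_splits_of_aeval (F := K) (K := Fbar)
      (E := MvPolynomial (ElimVar m) K ⧸ M) (x := q (MvPolynomial.X ElimVar.t)) (y := t)
      (fun s => ⟨Algebra.IsIntegral.isIntegral s, IsAlgClosed.splits _⟩)
      (hmin ▸ minpoly.aeval K t)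
    obtain ⟨hpt, hval⟩ := isNoncriticalTangencyPoint_of_tangencyIdeal_le_ker (p := p) (a := a)
      (ev := ι.comp q) (fun f hf => by
        change ι (Ideal.Quotient.mk M f) = 0
        rw [Ideal.Quotient.eq_zero_iff_mem.2 (hle (Ideal.mem_sup_left hf)), map_zero])
    exact ⟨_, mem_Delta_iff.2 hpt, hval.trans hι⟩
  · rintro ⟨x, hx, rfl⟩
    obtain ⟨ev, hev, hevt⟩ := (mem_Delta_iff.1 hx).exists_algHom
    have := hev _ hφI
    rwa [map_inclT, hevt] at this

theorem IsSquarefreePart.isTangencyValuePolynomial {φ θ : Polynomial K}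
    (hφ : Ideal.span {φ} = elimIdeal p a) (hθ : IsSquarefreePart φ θ) :
    IsTangencyValuePolynomial p a θ := by
  have hφ0 : φ ≠ 0 := ne_zero_of_span_eq_elimIdeal hφ
  have : CharZero K := charZero_of_injective_algebraMap (algebraMap ℝ K).injective
  obtain ⟨g, -, hg2, hg3, hg4⟩ := hθ
  obtain ⟨h1, h2⟩ := separable_and_root_iff_of_eq_mul_gcd (F := Fbar) hφ0 hg2 hg3 hg4
  exact ⟨h1, Set.ext fun t => (h2 t).trans (root_iff_mem_tangencyValues hφ t)⟩

theorem IsTangencyValuePolynomial.iff_eq_C_mul {φ : Polynomial K}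
    (hφ : IsTangencyValuePolynomial p a φ) (ψ : Polynomial K) :
    IsTangencyValuePolynomial p a ψ ↔ ∃ c : K, c ≠ 0 ∧ ψ = Polynomial.C c * φ := by
  constructor
  · intro hψ
    obtain ⟨u, hu⟩ := associated_of_separable_of_root_iff (F := Fbar) hφ.1 hψ.1
      fun t => Set.ext_iff.1 (hφ.2.trans hψ.2.symm) t
    obtain ⟨c, hc, hcu⟩ := Polynomial.isUnit_iff.1 u.isUnit
    exact ⟨c, hc.ne_zero, by rw [← hu, hcu, mul_comm]⟩
  · rintro ⟨c, hc, rfl⟩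
    refine ⟨?_, ?_⟩
    · exact hφ.1.unit_mul (Polynomial.isUnit_C.2 hc.isUnit)
    · rw [← hφ.2]
      ext t
      simp [hc]

theorem exists_isSquarefreePart (f : Polynomial K) : ∃ θ, IsSquarefreePart f θ := by
  classical
  obtain ⟨θ, hθ⟩ := EuclideanDomain.gcd_dvd_left f (Polynomial.derivative f)
  exact ⟨θ, _, EuclideanDomain.gcd_dvd_left _ _, EuclideanDomain.gcd_dvd_right _ _,
    fun d => EuclideanDomain.dvd_gcd, hθ.trans (mul_comm _ _)⟩

end Points

end Tangency

theorem proposition3p7 (m : ℕ) (p : MvPolynomial (Fin (m + 1)) ℝ)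
    (_hp : ∀ c : ℝ, p ≠ MvPolynomial.C c) (a : Fin (m + 1) → ℝ) :
    (∃ φ : Polynomial Tangency.K,
      Tangency.IsTangencyValuePolynomial p a φ ∧
      ∀ ψ : Polynomial Tangency.K, Tangency.IsTangencyValuePolynomial p a ψ ↔
        ∃ c : Tangency.K, c ≠ 0 ∧ ψ = Polynomial.C c * φ) ∧
    (∃ φbar θ : Polynomial Tangency.K,
      φbar ≠ 0 ∧ Ideal.span {φbar} = Tangency.elimIdeal p a ∧
      Tangency.IsSquarefreePart φbar θ) ∧
    (∀ φbar θ : Polynomial Tangency.K,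
      Ideal.span {φbar} = Tangency.elimIdeal p a →
      Tangency.IsSquarefreePart φbar θ →
      Tangency.IsTangencyValuePolynomial p a θ) := by
  obtain ⟨φ, hφ⟩ := (IsPrincipalIdealRing.principal (Tangency.elimIdeal p a)).principal
  have hspan : Ideal.span {φ} = Tangency.elimIdeal p a := hφ.symm
  obtain ⟨θ, hθ⟩ := Tangency.exists_isSquarefreePart φ
  have hval := hθ.isTangencyValuePolynomial hspan
  refine ⟨⟨θ, hval, hval.iff_eq_C_mul⟩, ⟨φ, θ, ?_, hspan, hθ⟩,
    fun _ _ h h' => h'.isTangencyValuePolynomial h⟩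
  exact Tangency.ne_zero_of_span_eq_elimIdeal hspan
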